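/- Let $C(3,3)$ be the semigroup of nonempty finite words over $\{s,t\}$, where two words are identified if they act identically (as compositions of operators) on every poset $(L,\le)$ for all order-preserving maps $s,t:L\to L$ with $s\le t$ (pointwise), $s^3=s$ and $t^3=t$; order it by letting $w_1\le w_2$ if $w_1(x)\le w_2(x)$ for all such $(L,\le,s,t)$ and all $x\in L$. Then $C(3,3)$ has exactly twelve elements, represented by the words $s$, $ss$, $t$, $tt$, $st$, $sst$, $ts$, $tts$, $sts$, $ssts$, $tst$, $ttst$. For each of the 52 systems of equations listed below, the congruence on $C(3,3)$ generated by the system identifies two of the twelve words exactly when they are equal or joined by a chain of equalities in the system, and the 52 congruences obtained in this way are pairwise distinct. For every poset $(L,\le)$ and all order-preserving $s\le t$ on $L$ with $s^3=s$ and $t^3=t$, there is exactly one of these 52 congruences $q$ such that the set of operators generated by $s$ and $t$ under composition (compositions of at least one factor) is canonically isomorphic to $C(3,3)/q$: the operators denoted by two words are equal if and only if the words are congruent modulo $q$. Moreover, under this isomorphism the pointwise order of the operators is the least transitive relation on $C(3,3)/q$ that makes the quotient map from $C(3,3)$ monotone. All 52 quotients occur, each of them for some poset with at most eight points. The 52 systems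 of equations (twelve words; a word that is not mentioned is congruent only to itself): 1. $s=ss=t=tt=st=sst=ts=tts=sts=ssts=tst=ttst$; 2. $s=t=sst=tts=sts=tst,\ ss=tt=st=ts=ssts=ttst$; 3. $s=ss=st=sst=ts=tts=sts=ssts=tst=ttst,\ t=tt$; 4. $s=ss=st=sst=sts=ssts,\ t=tt=ts=tts=tst=ttst$; 5. $s=ss=ts=tts=sts=ssts,\ t=tt=st=sst=tst=ttst$; 6. $s=ss,\ t=tt=st=sst=ts=tts=sts=ssts=tst=ttst$; 7. $s=sst=tts=sts=tst,\ ss=st=ts=ssts=ttst$; 8. $s=sst=sts,\ ss=st=ssts,\ t=tts=tst,\ tt=ts=ttst$; 9. $s=tts=sts,\ ss=ts=ssts,\ t=sst=tst,\ tt=st=ttst$; 10. $t=sst=tts=sts=tst,\ tt=st=ts=ssts=ttst$; 11. $s=ss,\ t=tt=st=sst=tst=ttst,\ ts=tts=sts=ssts$; 12. $t=sst=tst,\ tt=st=ttst,\ ts=ssts,\ tts=sts$; 13. $t=tt=st=sst=ts=tts=sts=ssts=tst=ttst$; 14. $t=tt=st=sst=tst=ttst,\ ts=tts=sts=ssts$;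 15. $s=ss=st=sst=ts=tts=sts=ssts=tst=ttst$; 16. $s=ss=ts=tts=sts=ssts,\ t=tt,\ st=sst=tst=ttst$; 17. $s=tts=sts,\ ss=ts=ssts,\ st=ttst,\ sst=tst$; 18. $s=ss=st=sst=sts=ssts,\ t=tt,\ ts=tts=tst=ttst$; 19. $s=ss,\ t=tt,\ st=sst=ts=tts=sts=ssts=tst=ttst$; 20. $s=ss,\ t=tt=ts=tts=tst=ttst,\ st=sst=sts=ssts$; 21. $s=ss=sts=ssts,\ t=tt=tst=ttst,\ st=sst,\ ts=tts$; 22. $s=sst=sts,\ ss=st=ssts,\ ts=ttst,\ tts=tst$; 23. $st=ts=ssts=ttst,\ sst=tts=sts=tst$; 24. $t=tts=tst,\ tt=ts=ttst,\ st=ssts,\ sst=sts$; 25. $s=sts,\ ss=ssts,\ t=tst,\ tt=ttst$; 26. $s=ss,\ t=tt,\ st=sst=tst=ttst,\ ts=tts=sts=ssts$; 27. $st=ttst,\ sst=tst,\ ts=ssts,\ tts=sts$; 28. $s=ss,\ t=tt=tst=ttst,\ st=sst,\ ts=tts,\ sts=ssts$; 29. $t=tst,\ tt=ttst$; 30. $t=tt,\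 st=sst=ts=tts=sts=ssts=tst=ttst$; 31. $t=tt=ts=tts=tst=ttst,\ st=sst=sts=ssts$; 32. $t=tt,\ st=sst=tst=ttst,\ ts=tts=sts=ssts$; 33. $t=tt=tst=ttst,\ st=sst,\ ts=tts,\ sts=ssts$; 34. $s=ss=ts=tts=sts=ssts,\ st=sst=tst=ttst$; 35. $s=ss=st=sst=sts=ssts,\ ts=tts=tst=ttst$; 36. $s=ss,\ st=sst=ts=tts=sts=ssts=tst=ttst$; 37. $s=ss=sts=ssts,\ t=tt,\ st=sst,\ ts=tts,\ tst=ttst$; 38. $s=sts,\ ss=ssts$; 39. $s=ss,\ st=sst=tst=ttst,\ ts=tts=sts=ssts$; 40. $st=sst=ts=tts=sts=ssts=tst=ttst$; 41. $st=sst=tst=ttst,\ ts=tts=sts=ssts$; 42. $s=ss,\ t=tt,\ st=sst=sts=ssts,\ ts=tts=tst=ttst$; 43. $st=ssts,\ sst=sts,\ ts=ttst,\ tts=tst$; 44. $s=ss,\ t=tt,\ st=sst,\ ts=tts,\ sts=ssts,\ tst=ttst$; 45. no equations; 46. $t=tt,\ st=sst=sts=ssts,\ ts=tts=tst=ttst$;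 47. $t=tt,\ st=sst,\ ts=tts,\ sts=ssts,\ tst=ttst$; 48. $s=ss=sts=ssts,\ st=sst,\ ts=tts,\ tst=ttst$; 49. $s=ss,\ st=sst=sts=ssts,\ ts=tts=tst=ttst$; 50. $s=ss,\ st=sst,\ ts=tts,\ sts=ssts,\ tst=ttst$; 51. $st=sst=sts=ssts,\ ts=tts=tst=ttst$; 52. $st=sst,\ ts=tts,\ sts=ssts,\ tst=ttst$. -/

import Mathlib

universe u

namespace Chittenden

/-- The two-letter alphabet. -/
inductive Letter
  | s
  | t

/-- Nonempty finite words over the alphabet, multiplied by concatenation. -/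
abbrev Word := FreeSemigroup Letter

/-- Two order-preserving endofunctions `s ≤ t` of a poset with `s ^ m = s` and `t ^ n = t`.
The product on `L →o L` is composition, `(f * g) x = f (g x)`. -/
structure OperatorPair (m n : ℕ) (L : Type u) [PartialOrder L] where
  s : L →o L
  t : L →o L
  s_le_t : s ≤ t
  s_pow : s ^ m = s
  t_pow : t ^ n = t

namespace OperatorPair

variable {m n : ℕ} {L : Type u} [PartialOrder L]

/-- The operator denoted by a letter. -/
def letter (p : OperatorPair m n L) : Letter → (L →o L)
  | .s => p.s
  | .t => p.t

/-- The operator denoted by a word: the composition of its letters. -/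
def eval (p : OperatorPair m n L) : Word →ₙ* (L →o L) := FreeSemigroup.lift p.letter

/-- The operators generated by `s` and `t` under composition (all compositions of at least one
factor; the identity belongs to it only if it is such a composition). -/
def generated (p : OperatorPair m n L) : Subsemigroup (L →o L) :=
  Subsemigroup.closure {p.s, p.t}

end OperatorPair

/-- Two words are identified if they act identically for all such pairs on all posets. -/
def wordCon (m n : ℕ) : Con Word where
  r w w' := ∀ (L : Type u) [PartialOrder L] (p : OperatorPair m n L), p.eval w = p.eval w'
  iseqv :=
    { refl := fun _ _ _ _ => rfl
      symm := fun h L _ p => (h L p).symm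
      trans := fun h h' L _ p => (h L p).trans (h' L p) }
  mul' := fun h h' L _ p => by rw [map_mul, map_mul, h L p, h' L p]

/-- The universal semigroup `C(m, n)` of words modulo acting identically for all such pairs. -/
def C (m n : ℕ) : Type := (wordCon.{u} m n).Quotient

instance (m n : ℕ) : Mul (C.{u} m n) := inferInstanceAs (Mul (wordCon.{u} m n).Quotient)

/-- The class of a word. -/
def C.mk (m n : ℕ) (w : Word) : C.{u} m n := (w : (wordCon.{u} m n).Quotient)

/-- The action of the elements of `C(m, n)` as operators, for a given pair. -/
def OperatorPair.action {m n : ℕ} {L : Type u} [PartialOrder L] (p : OperatorPair m n L) :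
    C.{u} m n →ₙ* (L →o L) where
  toFun x := Con.liftOn x (fun w => p.eval w) (fun _ _ h => h L p)
  map_mul' x y := Con.induction_on₂ x y (fun w w' => p.eval.map_mul w w')

/-- The order of `C(m, n)`: `x ≤ y` if `x` acts below `y` for all such pairs on all posets. -/
instance (m n : ℕ) : PartialOrder (C.{u} m n) where
  le x y := ∀ (L : Type u) [PartialOrder L] (p : OperatorPair m n L), p.action x ≤ p.action y
  le_refl _ _ _ _ := le_rfl
  le_trans _ _ _ h h' L _ p := (h L p).trans (h' L p)
  le_antisymm x y := Con.induction_on₂ x y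
    (fun _ _ h h' => (Con.eq _).2 (fun L _ p => le_antisymm (h L p) (h' L p)))

/-- The relation on a quotient of `C(m, n)` induced by the order of `C(m, n)`: the least
transitive relation that makes the quotient map monotone. -/
def quotientLE {m n : ℕ} (q : Con (C.{u} m n)) : q.Quotient → q.Quotient → Prop :=
  Relation.TransGen (fun a b => ∃ x y : C.{u} m n, x ≤ y ∧ (x : q.Quotient) = a ∧ (y : q.Quotient) = b)

/-- The operators generated by the pair `p` are the quotient of `C(m, n)` by `q`, both as a
semigroup with two distinguished generators and as an ordered set. -/
def Generates {m n : ℕ} {L : Type u} [PartialOrder L] (p : OperatorPair m n L)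
    (q : Con (C.{u} m n)) : Prop :=
  ∃ e : q.Quotient ≃* p.generated,
    (∀ x : C.{u} m n, (e (x : q.Quotient) : L →o L) = p.action x) ∧
    (∀ a b : q.Quotient, (e a : L →o L) ≤ (e b : L →o L) ↔ quotientLE q a b)

/-- The twelve words that represent the elements of `C(3, 3)`. -/
inductive NormalWord
  | s | ss | t | tt | st | sst | ts | tts | sts | ssts | tst | ttst
  deriving DecidableEq

/-- A normal word as a word. -/
def NormalWord.toWord : NormalWord → Word :=
  let S : Word := FreeSemigroup.of Letter.s
  let T : Word := FreeSemigroup.of Letter.t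
  fun
  | s => S
  | ss => S * S
  | t => T
  | tt => T * T
  | st => S * T
  | sst => S * S * T
  | ts => T * S
  | tts => T * T * S
  | sts => S * T * S
  | ssts => S * S * T * S
  | tst => T * S * T
  | ttst => T * T * S * T

section
open NormalWord

/-- The 52 partitions of the twelve words into blocks of words that become equal. -/
def partition : Fin 52 → List (List NormalWord) :=
  ![
    [[s, ss, t, tt, st, sst, ts, tts, sts, ssts, tst, ttst]],
    [[s, t, sst, tts, sts, tst], [ss, tt, st, ts, ssts, ttst]],
    [[s, ss, st, sst, ts, tts, sts, ssts, tst, ttst], [t, tt]],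
    [[s, ss, st, sst, sts, ssts], [t, tt, ts, tts, tst, ttst]],
    [[s, ss, ts, tts, sts, ssts], [t, tt, st, sst, tst, ttst]],
    [[s, ss], [t, tt, st, sst, ts, tts, sts, ssts, tst, ttst]],
    [[s, sst, tts, sts, tst], [ss, st, ts, ssts, ttst], [t], [tt]],
    [[s, sst, sts], [ss, st, ssts], [t, tts, tst], [tt, ts, ttst]],
    [[s, tts, sts], [ss, ts, ssts], [t, sst, tst], [tt, st, ttst]],
    [[s], [ss], [t, sst, tts, sts, tst], [tt, st, ts, ssts, ttst]],
    [[s, ss], [t, tt, st, sst, tst, ttst], [ts, tts, sts, ssts]],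
    [[s], [ss], [t, sst, tst], [tt, st, ttst], [ts, ssts], [tts, sts]],
    [[s], [ss], [t, tt, st, sst, ts, tts, sts, ssts, tst, ttst]],
    [[s], [ss], [t, tt, st, sst, tst, ttst], [ts, tts, sts, ssts]],
    [[s, ss, st, sst, ts, tts, sts, ssts, tst, ttst], [t], [tt]],
    [[s, ss, ts, tts, sts, ssts], [t, tt], [st, sst, tst, ttst]],
    [[s, tts, sts], [ss, ts, ssts], [t], [tt], [st, ttst], [sst, tst]],
    [[s, ss, st, sst, sts, ssts], [t, tt], [ts, tts, tst, ttst]],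
    [[s, ss], [t, tt], [st, sst, ts, tts, sts, ssts, tst, ttst]],
    [[s, ss], [t, tt, ts, tts, tst, ttst], [st, sst, sts, ssts]],
    [[s, ss, sts, ssts], [t, tt, tst, ttst], [st, sst], [ts, tts]],
    [[s, sst, sts], [ss, st, ssts], [t], [tt], [ts, ttst], [tts, tst]],
    [[s], [ss], [t], [tt], [st, ts, ssts, ttst], [sst, tts, sts, tst]],
    [[s], [ss], [t, tts, tst], [tt, ts, ttst], [st, ssts], [sst, sts]],
    [[s, sts], [ss, ssts], [t, tst], [tt, ttst], [st], [sst], [ts], [tts]],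
    [[s, ss], [t, tt], [st, sst, tst, ttst], [ts, tts, sts, ssts]],
    [[s], [ss], [t], [tt], [st, ttst], [sst, tst], [ts, ssts], [tts, sts]],
    [[s, ss], [t, tt, tst, ttst], [st, sst], [ts, tts], [sts, ssts]],
    [[s], [ss], [t, tst], [tt, ttst], [st], [sst], [ts], [tts], [sts], [ssts]],
    [[s], [ss], [t, tt], [st, sst, ts, tts, sts, ssts, tst, ttst]],
    [[s], [ss], [t, tt, ts, tts, tst, ttst], [st, sst, sts, ssts]],
    [[s], [ss], [t, tt], [st, sst, tst, ttst], [ts, tts, sts, ssts]],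
    [[s], [ss], [t, tt, tst, ttst], [st, sst], [ts, tts], [sts, ssts]],
    [[s, ss, ts, tts, sts, ssts], [t], [tt], [st, sst, tst, ttst]],
    [[s, ss, st, sst, sts, ssts], [t], [tt], [ts, tts, tst, ttst]],
    [[s, ss], [t], [tt], [st, sst, ts, tts, sts, ssts, tst, ttst]],
    [[s, ss, sts, ssts], [t, tt], [st, sst], [ts, tts], [tst, ttst]],
    [[s, sts], [ss, ssts], [t], [tt], [st], [sst], [ts], [tts], [tst], [ttst]],
    [[s, ss], [t], [tt], [st, sst, tst, ttst], [ts, tts, sts, ssts]],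
    [[s], [ss], [t], [tt], [st, sst, ts, tts, sts, ssts, tst, ttst]],
    [[s], [ss], [t], [tt], [st, sst, tst, ttst], [ts, tts, sts, ssts]],
    [[s, ss], [t, tt], [st, sst, sts, ssts], [ts, tts, tst, ttst]],
    [[s], [ss], [t], [tt], [st, ssts], [sst, sts], [ts, ttst], [tts, tst]],
    [[s, ss], [t, tt], [st, sst], [ts, tts], [sts, ssts], [tst, ttst]],
    [[s], [ss], [t], [tt], [st], [sst], [ts], [tts], [sts], [ssts], [tst], [ttst]],
    [[s], [ss], [t, tt], [st, sst, sts, ssts], [ts, tts, tst, ttst]],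
    [[s], [ss], [t, tt], [st, sst], [ts, tts], [sts, ssts], [tst, ttst]],
    [[s, ss, sts, ssts], [t], [tt], [st, sst], [ts, tts], [tst, ttst]],
    [[s, ss], [t], [tt], [st, sst, sts, ssts], [ts, tts, tst, ttst]],
    [[s, ss], [t], [tt], [st, sst], [ts, tts], [sts, ssts], [tst, ttst]],
    [[s], [ss], [t], [tt], [st, sst, sts, ssts], [ts, tts, tst, ttst]],
    [[s], [ss], [t], [tt], [st, sst], [ts, tts], [sts, ssts], [tst, ttst]]]

end

/-- The two words lie in a common block of the `i`-th partition. -/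
def SameBlock (i : Fin 52) (v w : NormalWord) : Prop := ∃ B ∈ partition i, v ∈ B ∧ w ∈ B

/-- The congruence on `C(3, 3)` generated by the equations of the `i`-th partition. -/
def collapse (i : Fin 52) : Con (C.{u} 3 3) :=
  conGen (fun x y => ∃ v w, SameBlock i v w ∧ x = C.mk 3 3 v.toWord ∧ y = C.mk 3 3 w.toWord)

end Chittenden

/-!
Up to parity of length, the words over `s ≤ t` with `s ^ 3 = s` and `t ^ 3 = t` behave like words
in two idempotents: `stst = st` and `tsts = ts`, and `tss = tts`, `stt = sst` move a repetition to
the front. So the twelve normal words are six types in two parities, and the types form the lattice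
`s < sts < st, ts < tst < t`. The operators generated by a pair define a preorder on the normal
words that satisfies `s ≤ t` and is stable under multiplication on both sides. The heart of the
matter is that such a preorder is determined by which of seven equations ("laws") hold in it
(`IsStable.iff_forall_separates`).

* The four prime filters of the lattice of types correspond to the laws `t = tst`, `s = sts`,
  `st = ssts` and `ts = ssts`: a comparison `x ≤ y` with `x` in the filter and `y` outside holds only if
  the law does, because a suitable multiplication sends one side of the filter to one side of the
  law.
* Comparing words of different parity forces `sts = ssts`, by multiplication with `st` and `ts`;
  two further laws, `s = ss` and `t = tt`, are needed if both words are powers of `s` or both of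
  `t`.
* Conversely, the laws that separate `x` from `y` provide a chain from `x` to `y`.

The laws `s = ss` and `t = tt` both imply `sts = ssts`, and in the presence of the latter `t = tst`
implies `t = tt` and `s = sts` implies `s = ss`; there are no other implications. This leaves
`2 ^ 4 + 3 * 3 * 4 = 52` sets of laws, and they are those of the 52 systems (`exists_hasLaw`).

For the order of the operators no separate work is needed: the relation that a quotient inherits
from `C(3, 3)` is a stable preorder as well, so it contains every stable preorder whose laws are
among its own, in particular the pointwise order (`generates_of_con_iff`). Finally, each of the 52
sets of laws is that of an explicit pair on eight points (`Model.generates`), which shows at once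
that the twelve words are distinct, that each system generates a congruence with the stated
classes, and that all 52 occur.
-/

namespace Chittenden

/-! ### Separating laws -/

instance : Fintype NormalWord where
  elems := {.s, .ss, .t, .tt, .st, .sst, .ts, .tts, .sts, .ssts, .tst, .ttst}
  complete w := by cases w <;> decide

instance (i : Fin 52) (v w : NormalWord) : Decidable (SameBlock i v w) :=
  inferInstanceAs (Decidable (∃ B ∈ partition i, v ∈ B ∧ w ∈ B))

/-- The seven equations `lhs = rhs` between normal words that determine a quotient of `C(3, 3)`. -/
inductive Law
  | t_tst | s_sts | st_ssts | ts_ssts | sts_ssts | s_ss | t_tt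
  deriving DecidableEq

instance : Fintype Law where
  elems := {.t_tst, .s_sts, .st_ssts, .ts_ssts, .sts_ssts, .s_ss, .t_tt}
  complete l := by cases l <;> decide

/-- The left side of a law. -/
def Law.lhs : Law → NormalWord
  | t_tst => .t
  | s_sts => .s
  | st_ssts => .st
  | ts_ssts => .ts
  | sts_ssts => .sts
  | s_ss => .s
  | t_tt => .t

/-- The right side of a law. -/
def Law.rhs : Law → NormalWord
  | t_tst => .tst
  | s_sts => .sts
  | st_ssts => .ssts
  | ts_ssts => .ssts
  | sts_ssts => .ssts
  | s_ss => .ss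
  | t_tt => .tt

namespace NormalWord

/-- The normal words of odd length. -/
def odd : NormalWord → Bool
  | s | t | sst | tts | sts | tst => true
  | _ => false

/-- `x` is `s` or `ss`. -/
def isS (x : NormalWord) : Bool := x ∈ [s, ss]

/-- `x` is `t` or `tt`. -/
def isT (x : NormalWord) : Bool := x ∈ [t, tt]

/-- `x` lies above `st` or `sst`: up to parity it is one of `st`, `tst`, `t`. -/
def aboveST (x : NormalWord) : Bool := x ∈ [st, sst, tst, ttst, t, tt]

/-- `x` lies above `ts` or `tts`: up to parity it is one of `ts`, `tst`, `t`. -/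
def aboveTS (x : NormalWord) : Bool := x ∈ [ts, tts, tst, ttst, t, tt]

/-- The laws without which `x ≤ y` fails. The first four are attached to the four prime filters of
the six-element lattice `s < sts < st, ts < tst < t` of the words up to parity, and separate `x`
from `y` if the filter contains `x` but not `y`; the last three separate words of different
parity. -/
def Separates (x y : NormalWord) : Law → Prop
  | .t_tst => x.isT ∧ ¬ y.isT
  | .s_sts => ¬ x.isS ∧ y.isS
  | .st_ssts => x.aboveST ∧ ¬ y.aboveST
  | .ts_ssts => x.aboveTS ∧ ¬ y.aboveTS
  | .sts_ssts => x.odd ≠ y.odd ∧ ¬ (x.isS ∧ y.isS) ∧ ¬ (x.isT ∧ y.isT)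
  | .s_ss => x.odd ≠ y.odd ∧ x.isS ∧ y.isS
  | .t_tt => x.odd ≠ y.odd ∧ x.isT ∧ y.isT

instance (x y : NormalWord) : DecidablePred (Separates x y) := fun l => by
  cases l <;> unfold Separates <;> infer_instance

end NormalWord

/-- The `i`-th system of equations contains the law `l`. -/
def HasLaw (i : Fin 52) (l : Law) : Prop := SameBlock i l.lhs l.rhs

instance (i : Fin 52) (l : Law) : Decidable (HasLaw i l) :=
  inferInstanceAs (Decidable (SameBlock i l.lhs l.rhs))

/-- The classes of the `i`-th partition are those of the preorder determined by its laws. -/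
theorem sameBlock_iff : ∀ (i : Fin 52) (v w : NormalWord), SameBlock i v w ↔
    (∀ l, v.Separates w l → HasLaw i l) ∧ (∀ l, w.Separates v l → HasLaw i l) := by
  decide +kernel

theorem hasLaw_injective : ∀ i j : Fin 52, (∀ l, HasLaw i l ↔ HasLaw j l) → i = j := by
  decide +kernel

/-- The implications that hold between the laws. -/
structure Consistent (σ : Law → Prop) : Prop where
  s_ss : σ .s_ss → σ .sts_ssts
  t_tt : σ .t_tt → σ .sts_ssts
  t_tst : σ .t_tst → σ .sts_ssts → σ .t_tt
  s_sts : σ .s_sts → σ .sts_ssts → σ .s_ss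

theorem exists_hasLaw_bool : ∀ σ : Law → Bool, (σ .s_ss → σ .sts_ssts) → (σ .t_tt → σ .sts_ssts) →
    (σ .t_tst → σ .sts_ssts → σ .t_tt) → (σ .s_sts → σ .sts_ssts → σ .s_ss) →
    ∃ i, ∀ l, HasLaw i l ↔ σ l := by
  decide +kernel

/-- Of the `2 ^ 4` consistent sets of laws without `sts_ssts` and the `3 * 3 * 4` with it, every
one is the set of laws of one of the 52 systems. -/
theorem exists_hasLaw {σ : Law → Prop} (h : Consistent σ) : ∃ i, ∀ l, HasLaw i l ↔ σ l := by
  classical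
  simpa using exists_hasLaw_bool (fun l => decide (σ l)) (by simpa using h.s_ss)
    (by simpa using h.t_tt) (by simpa using h.t_tst) (by simpa using h.s_sts)

/-! ### Stable preorders on the normal words -/

namespace NormalWord

/-- Left multiplication of normal words by a letter. -/
def consL : Letter → NormalWord → NormalWord
  | .s, s => ss
  | .s, ss => s
  | .s, t => st
  | .s, tt => sst
  | .s, st => sst
  | .s, sst => st
  | .s, ts => sts
  | .s, tts => ssts
  | .s, sts => ssts
  | .s, ssts => sts
  | .s, tst => st
  | .s, ttst => sst
  | .t, s => ts
  | .t, ss => tts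
  | .t, t => tt
  | .t, tt => t
  | .t, st => tst
  | .t, sst => ttst
  | .t, ts => tts
  | .t, tts => ts
  | .t, sts => ts
  | .t, ssts => tts
  | .t, tst => ttst
  | .t, ttst => tst

/-- Right multiplication of normal words by a letter. -/
def consR : NormalWord → Letter → NormalWord
  | s, .s => ss
  | ss, .s => s
  | t, .s => ts
  | tt, .s => tts
  | st, .s => sts
  | sst, .s => ssts
  | ts, .s => tts
  | tts, .s => ts
  | sts, .s => ssts
  | ssts, .s => sts
  | tst, .s => ts
  | ttst, .s => tts
  | s, .t => st
  | ss, .t => sst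
  | t, .t => tt
  | tt, .t => t
  | st, .t => sst
  | sst, .t => st
  | ts, .t => tst
  | tts, .t => ttst
  | sts, .t => st
  | ssts, .t => sst
  | tst, .t => ttst
  | ttst, .t => tst

end NormalWord

open NormalWord

/-- A preorder on the normal words with `s ≤ t` that is stable under multiplication on both
sides. -/
structure IsStable (R : NormalWord → NormalWord → Prop) : Prop where
  refl : ∀ x, R x x
  trans : ∀ {x y z}, R x y → R y z → R x z
  s_t : R .s .t
  left : ∀ l {x y}, R x y → R (consL l x) (consL l y)
  right : ∀ l {x y}, R x y → R (consR x l) (consR y l)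

/-- The laws that hold for the equivalence relation of a preorder. -/
def LawsOf (R : NormalWord → NormalWord → Prop) (l : Law) : Prop := R l.lhs l.rhs ∧ R l.rhs l.lhs

namespace IsStable

variable {R : NormalWord → NormalWord → Prop}

/-- The order `s < sts < st, ts < tst < t` of the words up to parity, in each of the two
parities. -/
theorem covers (h : IsStable R) :
    (R s sts ∧ R sts sst ∧ R sts tts ∧ R sst tst ∧ R tts tst ∧ R tst t) ∧
    (R ss ssts ∧ R ssts st ∧ R ssts ts ∧ R st ttst ∧ R ts ttst ∧ R ttst tt) := by
  have s_sts : R s sts := h.right .s (h.left .s h.s_t)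
  have sts_sst : R sts sst := h.left .s (h.left .t h.s_t)
  have sts_tts : R sts tts := h.right .s (h.right .t h.s_t)
  have sst_tst : R sst tst := h.right .t (h.right .s h.s_t)
  have tts_tst : R tts tst := h.left .t (h.left .s h.s_t)
  have tst_t : R tst t := h.right .t (h.left .t h.s_t)
  exact ⟨⟨s_sts, sts_sst, sts_tts, sst_tst, tts_tst, tst_t⟩, h.left .s s_sts, h.left .s sts_sst,
    h.right .s sts_tts, h.right .t sst_tst, h.left .t tts_tst, h.left .t tst_t⟩

/-- Multiplication by `st` on the left and by `ts` on the right sends the words of odd length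
to `sts` and those of even length to `ssts`. -/
theorem lawsOf_sts_ssts (h : IsStable R) {x y : NormalWord} (hxy : R x y) (hodd : x.odd ≠ y.odd) :
    LawsOf R .sts_ssts := by
  have key : ∀ z : NormalWord, consL .s (consL .t (consR (consR z .t) .s)) =
      if z.odd then sts else ssts := by decide
  have h₁ := h.left .s (h.left .t (h.right .s (h.right .t hxy)))
  rw [key, key] at h₁
  have h₂ := h.left .s h₁
  cases hx : x.odd <;> cases hy : y.odd <;> simp only [hx, hy] at h₁ h₂ hodd
  · exact absurd rfl hodd
  · exact ⟨h₂, h₁⟩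
  · exact ⟨h₁, h₂⟩
  · exact absurd rfl hodd

/-- A law that separates two comparable elements is obtained from the comparison by multiplying
with a letter once or twice, on the left or on the right: this sends everything on one side of the
separation to one side of the law, up to the relations that hold in every stable preorder. -/
theorem lawsOf_of_separates (h : IsStable R) {x y : NormalWord} (hxy : R x y) (l : Law)
    (hl : x.Separates y l) : LawsOf R l := by
  have hodd := h.lawsOf_sts_ssts hxy
  -- `hodd` changes the parity of the words of the middle types; it applies to mixed parities only
  by_cases hE : l = .sts_ssts
  · subst hE
    exact hodd hl.1
  have trans := @h.trans
  have covers := h.covers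
  have s₁ := h.left .s hxy
  have s₂ := h.left .s s₁
  have t₁ := h.left .t hxy
  have t₂ := h.left .t t₁
  have r₁ := h.right .s hxy
  have r₂ := h.right .s r₁
  cases l <;> cases x <;> cases y <;> first
    | exact absurd hl (by decide)
    | exact absurd rfl hE
    | (simp only [consL, consR, odd, LawsOf, Law.lhs, Law.rhs] at *; grind)

/-- Two words are joined by a chain of the relations that hold in every stable preorder and of the
laws that separate them, multiplied with letters. -/
theorem of_lawsOf (h : IsStable R) {x y : NormalWord}
    (hxy : ∀ l, x.Separates y l → LawsOf R l) : R x y := by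
  have trans := @h.trans
  have covers := h.covers
  have refl := h.refl
  -- the multiples of each law that lead from `x` towards `y`, available if the law separates them
  have h₁ : LawsOf R .t_tst → R t tst ∧ R tt ttst := fun l => ⟨l.1, h.left .t l.1⟩
  have h₂ : LawsOf R .s_sts → R sts s ∧ R ssts ss := fun l => ⟨l.2, h.left .s l.2⟩
  have h₃ : LawsOf R .st_ssts → R st ssts ∧ R sst sts ∧ R tst tts ∧ R ttst ts := fun l =>
    ⟨l.1, h.left .s l.1, h.left .t l.1, h.left .t (h.left .t l.1)⟩
  have h₄ : LawsOf R .ts_ssts → R ts ssts ∧ R tts sts ∧ R tst sst ∧ R ttst st := fun l =>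
    ⟨l.1, h.right .s l.1, h.right .t l.1, h.right .t (h.right .t l.1)⟩
  have h₅ : LawsOf R .sts_ssts → (R sts ssts ∧ R st sst ∧ R ts tts ∧ R tst ttst) ∧
      (R ssts sts ∧ R sst st ∧ R tts ts ∧ R ttst tst) := fun l =>
    ⟨⟨l.1, h.right .t l.1, h.left .t l.1, h.right .t (h.left .t l.1)⟩,
      ⟨l.2, h.right .t l.2, h.left .t l.2, h.right .t (h.left .t l.2)⟩⟩
  have h₆ : LawsOf R .s_ss → R s ss ∧ R ss s := id
  have h₇ : LawsOf R .t_tt → R t tt ∧ R tt t := id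
  have k₁ := fun hl => h₁ (hxy .t_tst hl)
  have k₂ := fun hl => h₂ (hxy .s_sts hl)
  have k₃ := fun hl => h₃ (hxy .st_ssts hl)
  have k₄ := fun hl => h₄ (hxy .ts_ssts hl)
  have k₅ := fun hl => h₅ (hxy .sts_ssts hl)
  have k₆ := fun hl => h₆ (hxy .s_ss hl)
  have k₇ := fun hl => h₇ (hxy .t_tt hl)
  clear h₁ h₂ h₃ h₄ h₅ h₆ h₇ hxy
  cases x <;> cases y <;>
    (simp [Separates, isS, isT, aboveST, aboveTS, odd] at k₁ k₂ k₃ k₄ k₅ k₆ k₇; grind)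

/-- A stable preorder is determined by its laws. -/
theorem iff_forall_separates (h : IsStable R) {x y : NormalWord} :
    R x y ↔ ∀ l, x.Separates y l → LawsOf R l :=
  ⟨h.lawsOf_of_separates, h.of_lawsOf⟩

/-- The implications between the laws: each follows by multiplying the first law with letters and
combining it with the second. -/
theorem consistent (h : IsStable R) : Consistent (LawsOf R) where
  s_ss := fun ⟨h₁, h₂⟩ => ⟨h.right .s (h.right .t h₁), h.right .s (h.right .t h₂)⟩
  t_tt := fun ⟨h₁, h₂⟩ => ⟨h.right .s (h.left .s h₁), h.right .s (h.left .s h₂)⟩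
  t_tst := fun ⟨h₁, h₂⟩ ⟨h₃, h₄⟩ => by
    have h₅ : R tst ttst := h.right .t (h.left .t h₃)
    have h₆ : R ttst tst := h.right .t (h.left .t h₄)
    exact ⟨h.trans h₁ (h.trans h₅ (h.left .t h₂)), h.trans (h.left .t h₁) (h.trans h₆ h₂)⟩
  s_sts := fun ⟨h₁, h₂⟩ ⟨h₃, h₄⟩ =>
    ⟨h.trans h₁ (h.trans h₃ (h.left .s h₂)), h.trans (h.left .s h₁) (h.trans h₄ h₂)⟩

end IsStable

/-! ### Reduction of words to normal words -/

namespace OperatorPair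

variable {L : Type u} [PartialOrder L] (p : OperatorPair 3 3 L)

theorem s_mul_s_mul_s : p.s * (p.s * p.s) = p.s := by
  rw [← pow_two, ← pow_succ', p.s_pow]

theorem t_mul_t_mul_t : p.t * (p.t * p.t) = p.t := by
  rw [← pow_two, ← pow_succ', p.t_pow]

theorem sss_apply (x : L) : p.s (p.s (p.s x)) = p.s x := DFunLike.congr_fun p.s_mul_s_mul_s x

theorem ttt_apply (x : L) : p.t (p.t (p.t x)) = p.t x := DFunLike.congr_fun p.t_mul_t_mul_t x

theorem tss_apply (x : L) : p.t (p.s (p.s x)) = p.t (p.t (p.s x)) := by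
  refine le_antisymm (p.t.mono (p.s_le_t _)) ?_
  calc p.t (p.t (p.s x)) = p.t (p.t (p.s (p.s (p.s x)))) := by rw [p.sss_apply]
    _ ≤ p.t (p.t (p.t (p.s (p.s x)))) := p.t.mono (p.t.mono (p.s_le_t _))
    _ = p.t (p.s (p.s x)) := p.ttt_apply _

theorem stt_apply (x : L) : p.s (p.t (p.t x)) = p.s (p.s (p.t x)) := by
  refine le_antisymm ?_ (p.s.mono (p.s_le_t _))
  calc p.s (p.t (p.t x)) = p.s (p.s (p.s (p.t (p.t x)))) := (p.sss_apply _).symm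
    _ ≤ p.s (p.s (p.t (p.t (p.t x)))) := p.s.mono (p.s.mono (p.s_le_t _))
    _ = p.s (p.s (p.t x)) := by rw [p.ttt_apply]

theorem stst_apply (x : L) : p.s (p.t (p.s (p.t x))) = p.s (p.t x) := by
  apply le_antisymm
  · calc p.s (p.t (p.s (p.t x))) ≤ p.s (p.t (p.t (p.t x))) := p.s.mono (p.t.mono (p.s_le_t _))
      _ = p.s (p.t x) := by rw [p.ttt_apply]
  · calc p.s (p.t x) = p.s (p.s (p.s (p.t x))) := (p.sss_apply _).symm
      _ ≤ p.s (p.t (p.s (p.t x))) := p.s.mono (p.s_le_t _)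

theorem tsts_apply (x : L) : p.t (p.s (p.t (p.s x))) = p.t (p.s x) := by
  apply le_antisymm
  · calc p.t (p.s (p.t (p.s x))) ≤ p.t (p.t (p.t (p.s x))) := p.t.mono (p.s_le_t _)
      _ = p.t (p.s x) := p.ttt_apply _
  · calc p.t (p.s x) = p.t (p.s (p.s (p.s x))) := by rw [p.sss_apply]
      _ ≤ p.t (p.s (p.t (p.s x))) := p.t.mono (p.s.mono (p.s_le_t _))

theorem eval_of (l : Letter) : p.eval (FreeSemigroup.of l) = p.letter l := rfl

theorem eval_consL (l : Letter) (w : NormalWord) :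
    p.eval (consL l w).toWord = p.letter l * p.eval w.toWord := by
  ext x
  cases l <;> cases w <;>
    simp [consL, toWord, eval_of, letter, sss_apply, ttt_apply, tss_apply, stt_apply, stst_apply,
      tsts_apply]

theorem eval_consR (w : NormalWord) (l : Letter) :
    p.eval (w.consR l).toWord = p.eval w.toWord * p.letter l := by
  ext x
  cases l <;> cases w <;>
    simp [consR, toWord, eval_of, letter, sss_apply, ttt_apply, tss_apply, stt_apply, stst_apply,
      tsts_apply]

end OperatorPair

namespace C

/-- The element of `C(3, 3)` represented by a normal word. -/
def nf (w : NormalWord) : C.{u} 3 3 := C.mk 3 3 w.toWord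

theorem ext_action {x y : C.{u} 3 3}
    (h : ∀ (L : Type u) [PartialOrder L] (p : OperatorPair 3 3 L), p.action x = p.action y) :
    x = y :=
  le_antisymm (by intro L _ p; exact (h L p).le) (by intro L _ p; exact (h L p).ge)

theorem mul_le_mul {w x y z : C.{u} 3 3} (h : w ≤ x) (h' : y ≤ z) : w * y ≤ x * z := by
  intro L _ p a
  rw [map_mul, map_mul]
  exact ((p.action w).mono (h' L p a)).trans (h L p _)

theorem nf_consL (l : Letter) (w : NormalWord) :
    nf.{u} (consL l w) = C.mk 3 3 (FreeSemigroup.of l) * nf w :=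
  ext_action fun L _ p => by rw [map_mul]; exact p.eval_consL l w

theorem nf_consR (w : NormalWord) (l : Letter) :
    nf.{u} (w.consR l) = nf w * C.mk 3 3 (FreeSemigroup.of l) :=
  ext_action fun L _ p => by rw [map_mul]; exact p.eval_consR w l

theorem nf_s_le_nf_t : nf.{u} s ≤ nf t := fun _ _ p => p.s_le_t

theorem nf_surjective : Function.Surjective nf.{u} := by
  intro x
  refine Con.induction_on x fun w => ?_
  induction w using FreeSemigroup.recOnMul with
  | ih1 l => cases l; exacts [⟨s, rfl⟩, ⟨t, rfl⟩]
  | ih2 l w _ ih =>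
    obtain ⟨v, hv⟩ := ih
    exact ⟨consL l v, (nf_consL l v).trans (congrArg _ hv)⟩

end C

open C

theorem isStable_action {L : Type u} [PartialOrder L] (p : OperatorPair 3 3 L) :
    IsStable fun v w => p.action (nf v) ≤ p.action (nf w) where
  refl _ := le_rfl
  trans := le_trans
  s_t := p.s_le_t
  left l x y h := by
    simp only [nf_consL, map_mul]
    exact fun a => (p.action _).mono (h a)
  right l x y h := by
    simp only [nf_consR, map_mul]
    exact fun a => h _

theorem quotientLE_mul_left {q : Con (C.{u} 3 3)} (x : C.{u} 3 3) {a b : q.Quotient}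
    (h : quotientLE q a b) : quotientLE q (x * a) (x * b) := by
  have step : ∀ {y z : C.{u} 3 3}, y ≤ z → quotientLE q (x * y) (x * z) := fun {y z} hyz =>
    .single ⟨x * y, x * z, mul_le_mul le_rfl hyz, rfl, rfl⟩
  induction h with
  | single h => obtain ⟨y, z, hyz, rfl, rfl⟩ := h; exact step hyz
  | tail _ h ih => obtain ⟨y, z, hyz, rfl, rfl⟩ := h; exact ih.trans (step hyz)

theorem quotientLE_mul_right {q : Con (C.{u} 3 3)} (x : C.{u} 3 3) {a b : q.Quotient}
    (h : quotientLE q a b) : quotientLE q (a * x) (b * x) := by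
  have step : ∀ {y z : C.{u} 3 3}, y ≤ z → quotientLE q (y * x) (z * x) := fun {y z} hyz =>
    .single ⟨y * x, z * x, mul_le_mul hyz le_rfl, rfl, rfl⟩
  induction h with
  | single h => obtain ⟨y, z, hyz, rfl, rfl⟩ := h; exact step hyz
  | tail _ h ih => obtain ⟨y, z, hyz, rfl, rfl⟩ := h; exact ih.trans (step hyz)

theorem quotientLE_of_le (q : Con (C.{u} 3 3)) {x y : C.{u} 3 3} (h : x ≤ y) : quotientLE q x y :=
  .single ⟨x, y, h, rfl, rfl⟩

/-- The order induced on a quotient of `C(3, 3)` is a stable preorder, like the pointwise order of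
operators. -/
theorem isStable_quotientLE (q : Con (C.{u} 3 3)) :
    IsStable fun v w => quotientLE q (nf v : q.Quotient) (nf w) where
  refl _ := quotientLE_of_le q le_rfl
  trans := Relation.TransGen.trans
  s_t := quotientLE_of_le q nf_s_le_nf_t
  left l x y h := by
    simp only [nf_consL, Con.coe_mul]
    exact quotientLE_mul_left _ h
  right l x y h := by
    simp only [nf_consR, Con.coe_mul]
    exact quotientLE_mul_right _ h

/-! ### The quotient generated by an operator pair -/

theorem mem_generated {L : Type u} [PartialOrder L] (p : OperatorPair 3 3 L) (f : L →o L) :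
    f ∈ p.generated ↔ ∃ x : C.{u} 3 3, p.action x = f := by
  constructor
  · intro hf
    induction hf using Subsemigroup.closure_induction with
    | mem f hf =>
      rcases hf with rfl | rfl
      exacts [⟨nf s, rfl⟩, ⟨nf t, rfl⟩]
    | mul f g _ _ hf hg =>
      obtain ⟨⟨x, rfl⟩, y, rfl⟩ := And.intro hf hg
      exact ⟨x * y, map_mul _ x y⟩
  · rintro ⟨x, rfl⟩
    refine Con.induction_on x fun w => ?_
    change p.eval w ∈ p.generated
    induction w using FreeSemigroup.recOnMul with
    | ih1 l =>
      cases l <;>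
        exact Subsemigroup.subset_closure (by simp [OperatorPair.eval_of, OperatorPair.letter])
    | ih2 l w h₁ h₂ => rw [map_mul]; exact mul_mem h₁ h₂

theorem Generates.con_iff {L : Type u} [PartialOrder L] {p : OperatorPair 3 3 L}
    {q : Con (C.{u} 3 3)} (h : Generates p q) {x y : C.{u} 3 3} :
    q x y ↔ p.action x = p.action y := by
  obtain ⟨e, he, -⟩ := h
  rw [← he, ← he, SetLike.coe_eq_coe, e.injective.eq_iff, Con.eq]

/-- If the congruence `q` is the kernel of the action of an operator pair, then the pointwise
order is the one induced by `C(3, 3)`: both orders are stable preorders on the normal words, with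
the same laws. -/
theorem generates_of_con_iff {L : Type u} [PartialOrder L] {p : OperatorPair 3 3 L}
    {q : Con (C.{u} 3 3)} (h : ∀ x y, q x y ↔ p.action x = p.action y) : Generates p q := by
  let f : q.Quotient →ₙ* p.generated :=
    { toFun a := Con.liftOn a (fun x => ⟨p.action x, (mem_generated p _).2 ⟨x, rfl⟩⟩)
        fun x y hxy => Subtype.ext ((h x y).1 hxy)
      map_mul' a b := Con.induction_on₂ a b fun x y => Subtype.ext (map_mul p.action x y) }
  have hf : Function.Bijective f := by
    constructor
    · intro a b
      refine Con.induction_on₂ a b fun x y hxy => (Con.eq _).2 ((h x y).2 ?_)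
      exact congrArg Subtype.val hxy
    · rintro ⟨g, hg⟩
      obtain ⟨x, rfl⟩ := (mem_generated p g).1 hg
      exact ⟨x, rfl⟩
  have mono : ∀ {a b}, quotientLE q a b → (f a : L →o L) ≤ f b := by
    intro a b hab
    induction hab with
    | single h =>
      obtain ⟨x, y, hxy, rfl, rfl⟩ := h
      exact hxy L p
    | tail _ h ih =>
      obtain ⟨x, y, hxy, rfl, rfl⟩ := h
      exact ih.trans (hxy L p)
  refine ⟨MulEquiv.ofBijective f hf, fun _ => rfl, fun a b => ⟨?_, mono⟩⟩
  refine Con.induction_on₂ a b fun x y hxy => ?_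
  obtain ⟨v, rfl⟩ := nf_surjective x
  obtain ⟨w, rfl⟩ := nf_surjective y
  refine (isStable_quotientLE q).of_lawsOf fun l hl => ?_
  obtain ⟨h₁, h₂⟩ := (isStable_action p).lawsOf_of_separates hxy l hl
  have hq : (nf l.lhs : q.Quotient) = nf l.rhs := (Con.eq _).2 ((h _ _).2 (le_antisymm h₁ h₂))
  constructor <;> simp only [hq] <;> exact quotientLE_of_le q le_rfl

/-- If the laws of a pair are those of the `i`-th system, then the pair identifies exactly the words
in a common block. -/
theorem action_eq_iff {L : Type u} [PartialOrder L] {p : OperatorPair 3 3 L} {i : Fin 52}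
    (h : ∀ l : Law, HasLaw i l ↔ p.action (nf l.lhs) = p.action (nf l.rhs)) (v w : NormalWord) :
    p.action (nf v) = p.action (nf w) ↔ SameBlock i v w := by
  have hl : ∀ l, LawsOf (fun v w => p.action (nf v) ≤ p.action (nf w)) l ↔ HasLaw i l :=
    fun l => le_antisymm_iff.symm.trans (h l).symm
  rw [sameBlock_iff, le_antisymm_iff, (isStable_action p).iff_forall_separates,
    (isStable_action p).iff_forall_separates]
  simp only [hl]

theorem generates_collapse {L : Type u} [PartialOrder L] {p : OperatorPair 3 3 L} {i : Fin 52}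
    (h : ∀ l : Law, HasLaw i l ↔ p.action (nf l.lhs) = p.action (nf l.rhs)) :
    Generates p (collapse i) := by
  refine generates_of_con_iff fun x y => ⟨fun hxy => ?_, fun hxy => ?_⟩
  · induction hxy with
    | of x y h' =>
      obtain ⟨v, w, hvw, rfl, rfl⟩ := h'
      exact (action_eq_iff h v w).2 hvw
    | refl => rfl
    | symm _ ih => exact ih.symm
    | trans _ _ ih₁ ih₂ => exact ih₁.trans ih₂
    | mul _ _ ih₁ ih₂ => rw [map_mul, map_mul, ih₁, ih₂]
  · obtain ⟨v, rfl⟩ := nf_surjective x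
    obtain ⟨w, rfl⟩ := nf_surjective y
    exact .of _ _ ⟨v, w, (action_eq_iff h v w).1 hxy, rfl, rfl⟩

theorem exists_generates_collapse {L : Type u} [PartialOrder L] (p : OperatorPair 3 3 L) :
    ∃ i, Generates p (collapse i) := by
  obtain ⟨i, hi⟩ := exists_hasLaw (isStable_action p).consistent
  exact ⟨i, generates_collapse fun l => (hi l).trans le_antisymm_iff.symm⟩

/-! ### Eight-point models -/

/-- The points of the models. In the richest case `x` is mapped to `a₀` by `s` and to `b₀` by `t`,
the points `a₀`, `a₁` are swapped by `s` and mapped into the chain `m₀ < m₁ < m₂` by `t`, and the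
points `b₀`, `b₁` are swapped by `t` and mapped into the chain by `s`. -/
inductive Point : Type u
  | x | a₀ | a₁ | m₀ | m₁ | m₂ | b₀ | b₁
  deriving DecidableEq

namespace Point

instance : Fintype Point.{u} where
  elems := {x, a₀, a₁, m₀, m₁, m₂, b₀, b₁}
  complete z := by cases z <;> decide

theorem card_eq : Nat.card Point.{u} = 8 := by
  rw [Nat.card_eq_fintype_card]
  rfl

/-- The layers of the order: `a₀`, `a₁` lie below the chain, and `b₀`, `b₁` above it. -/
def level : Point.{u} → ℕ
  | m₀ => 1
  | m₁ => 2
  | m₂ => 3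
  | b₀ | b₁ => 4
  | _ => 0

variable (i : Fin 52)

/-- The points of the connected part of the `i`-th model, on which the order is that of the levels.
The other points are comparable only to themselves. Of these, `x` is mapped into the connected part
by both operators, and the rest are fixed points of both, which have no influence on the laws,
except that `a₁` and `b₁` are swapped by both operators if the law `sts = ssts` fails. -/
def Connected : Point.{u} → Prop
  | x => False
  | a₀ => ¬ HasLaw i .s_sts
  | a₁ => HasLaw i .sts_ssts ∧ ¬ HasLaw i .s_ss
  | m₀ => ¬ HasLaw i .ts_ssts
  | m₁ => True
  | m₂ => ¬ HasLaw i .st_ssts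
  | b₀ => ¬ HasLaw i .t_tst
  | b₁ => HasLaw i .sts_ssts ∧ ¬ HasLaw i .t_tt

instance : DecidablePred (Connected.{u} i) := fun z => by
  cases z <;> unfold Connected <;> infer_instance

/-- The order of the `i`-th model. -/
def Le (y z : Point.{u}) : Prop :=
  y = z ∨ Connected i y ∧ Connected i z ∧ y.level < z.level

instance (y z : Point.{u}) : Decidable (Le i y z) :=
  inferInstanceAs (Decidable (y = z ∨ Connected i y ∧ Connected i z ∧ y.level < z.level))

/-- The least point of the chain. -/
def low : Point.{u} := if HasLaw i .ts_ssts then m₁ else m₀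

/-- The greatest point of the chain. -/
def high : Point.{u} := if HasLaw i .st_ssts then m₁ else m₂

/-- The lower operator of the `i`-th model. It maps the points above the chain to its greatest point
fixed by the operator, which is `m₂` if that belongs to the chain. -/
def sMap : Point.{u} → Point.{u}
  | x => if HasLaw i .s_sts then low i else a₀
  | a₀ => if Connected.{u} i a₁ then a₁ else a₀
  | a₁ => if Connected.{u} i a₁ then a₀ else if HasLaw i .sts_ssts then a₁ else b₁
  | m₁ => low i
  | b₀ => if Connected.{u} i b₀ then (if HasLaw i .st_ssts then low i else m₂) else b₀
  | b₁ => if Connected.{u} i b₁ then (if HasLaw i .st_ssts then low i else m₂)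
      else if HasLaw i .sts_ssts then b₁ else a₁
  | z => z

/-- The upper operator of the `i`-th model. It maps the points below the chain to its least point
fixed by the operator, which is always `m₁`. -/
def tMap : Point.{u} → Point.{u}
  | x => if HasLaw i .t_tst then high i else b₀
  | a₀ => if Connected.{u} i a₀ then m₁ else a₀
  | a₁ => if Connected.{u} i a₁ then m₁ else if HasLaw i .sts_ssts then a₁ else b₁
  | m₀ => if Connected.{u} i m₀ then m₁ else m₀
  | b₀ => if Connected.{u} i b₁ then b₁ else b₀
  | b₁ => if Connected.{u} i b₁ then b₀ else if HasLaw i .sts_ssts then b₁ else a₁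
  | z => z

theorem sMap_mono : ∀ (i : Fin 52) (y z : Point.{u}), Le i y z → Le i (sMap i y) (sMap i z) := by
  decide +kernel

theorem tMap_mono : ∀ (i : Fin 52) (y z : Point.{u}), Le i y z → Le i (tMap i y) (tMap i z) := by
  decide +kernel

theorem sMap_le_tMap : ∀ (i : Fin 52) (z : Point.{u}), Le i (sMap i z) (tMap i z) := by
  decide +kernel

theorem sMap_pow : ∀ (i : Fin 52) (z : Point.{u}), sMap i (sMap i (sMap i z)) = sMap i z := by
  decide +kernel

theorem tMap_pow : ∀ (i : Fin 52) (z : Point.{u}), tMap i (tMap i (tMap i z)) = tMap i z := by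
  decide +kernel

end Point

/-- The poset of the `i`-th model. -/
def Model (_ : Fin 52) : Type u := Point.{u}

namespace Model

variable (i : Fin 52)

instance : Fintype (Model.{u} i) := inferInstanceAs (Fintype Point)

instance : DecidableEq (Model.{u} i) := inferInstanceAs (DecidableEq Point)

instance : PartialOrder (Model.{u} i) where
  le := Point.Le i
  le_refl _ := .inl rfl
  le_trans := by
    rintro _ _ _ (rfl | ⟨h₁, h₁', h₂⟩) (rfl | ⟨h₃, h₄, h₅⟩)
    exacts [.inl rfl, .inr ⟨h₃, h₄, h₅⟩, .inr ⟨h₁, h₁', h₂⟩, .inr ⟨h₁, h₄, h₂.trans h₅⟩]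
  le_antisymm := by
    rintro _ _ (rfl | ⟨-, -, h⟩) (h' | ⟨-, -, h'⟩)
    exacts [rfl, rfl, h'.symm, absurd h h'.asymm]

/-- The operator pair of the `i`-th model. -/
def pair : OperatorPair 3 3 (Model.{u} i) where
  s := ⟨Point.sMap i, fun _ _ => Point.sMap_mono i _ _⟩
  t := ⟨Point.tMap i, fun _ _ => Point.tMap_mono i _ _⟩
  s_le_t := Point.sMap_le_tMap i
  s_pow := OrderHom.ext _ _ (funext (Point.sMap_pow i))
  t_pow := OrderHom.ext _ _ (funext (Point.tMap_pow i))

theorem hasLaw_iff_forall : ∀ (i : Fin 52) (l : Law), HasLaw i l ↔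
    ∀ z : Model.{u} i, (pair i).eval l.lhs.toWord z = (pair i).eval l.rhs.toWord z := by
  decide +kernel

theorem hasLaw_iff (l : Law) :
    HasLaw i l ↔ (pair.{u} i).action (nf l.lhs) = (pair i).action (nf l.rhs) :=
  (hasLaw_iff_forall i l).trans DFunLike.ext_iff.symm

theorem generates : Generates (pair.{u} i) (collapse i) := generates_collapse (hasLaw_iff i)

end Model

theorem collapse_nf_iff (i : Fin 52) (v w : NormalWord) :
    collapse.{u} i (nf v) (nf w) ↔ SameBlock i v w :=
  (Model.generates i).con_iff.trans (action_eq_iff (Model.hasLaw_iff i) v w)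

theorem collapse_injective : Function.Injective collapse.{u} := by
  intro i j h
  refine hasLaw_injective i j fun l => ?_
  rw [HasLaw, HasLaw, ← collapse_nf_iff.{u}, ← collapse_nf_iff.{u}, h]

theorem nf_injective : Function.Injective nf.{u} := by
  intro v w h
  -- the partition with index 44 contains no equations
  have key : ∀ v w, SameBlock 44 v w → v = w := by decide +kernel
  exact key v w ((collapse_nf_iff.{u} 44 v w).1 (h ▸ Con.refl _ _))

end Chittenden

open Chittenden in
theorem mainTheorem3 :
    -- the twelve words represent the elements of `C(3, 3)`
    Function.Bijective (fun w : NormalWord => C.mk.{u} 3 3 w.toWord) ∧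
    -- the blocks are exactly the classes of the congruences that they generate
    (∀ (i : Fin 52) (v w : NormalWord),
      collapse.{u} i (C.mk 3 3 v.toWord) (C.mk 3 3 w.toWord) ↔ SameBlock i v w) ∧
    -- the 52 quotients are distinct
    Function.Injective collapse.{u} ∧
    -- every pair generates one of them
    (∀ (L : Type u) [PartialOrder L] (p : OperatorPair 3 3 L),
      ∃! i : Fin 52, Generates p (collapse i)) ∧
    -- all of them occur, on posets with at most eight points
    (∀ i : Fin 52, ∃ (L : Type u) (_ : PartialOrder L) (p : OperatorPair 3 3 L),
      Finite L ∧ Nat.card L ≤ 8 ∧ Generates p (collapse i)) := by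
  refine ⟨⟨nf_injective, C.nf_surjective⟩, collapse_nf_iff, collapse_injective, fun L _ p => ?_,
    fun i => ⟨Model i, inferInstance, Model.pair i, inferInstance,
      Point.card_eq.le, Model.generates i⟩⟩
  obtain ⟨i, hi⟩ := exists_generates_collapse p
  refine ⟨i, hi, fun j hj => collapse_injective (Con.ext fun x y => ?_)⟩
  rw [hj.con_iff, hi.con_iff]
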